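/- Let $\mathbb W$ be the $d$-dimensional Weyl $C^*$-algebra: the completion of the $*$-algebra of finite linear combinations of monomials $u_\alpha v_\beta$ ($\alpha,\beta\in\mathbb R^d$), with relations $u_\alpha v_\beta=e^{i\alpha\cdot\beta}v_\beta u_\alpha$, $u_\alpha u_{\alpha'}=u_{\alpha+\alpha'}$, $v_\beta v_{\beta'}=v_{\beta+\beta'}$, $u_0=v_0=\mathbf 1$, $u_\alpha^*=u_{-\alpha}$, $v_\beta^*=v_{-\beta}$, in the norm $\|a\|=\sup_\rho\|\rho(a)\|$, the supremum being over all $*$-representations $\rho$ by bounded operators on Hilbert spaces. Put $\tau_\lambda(a)=v_\lambda a v_\lambda^*$ and $\theta_\alpha(a)=u_\alpha a u_\alpha^*$. Let $e^1,\dots,e^d$ be a basis of $\mathbb R^d$, let $\Gamma=\bigoplus_i\mathbb Z e^i$, let $\Gamma'=\{\gamma'\in\mathbb R^d : \gamma'\cdot\gamma\in 2\pi\mathbb Z\ \ \forall\gamma\in\Gamma\}$ be the dual lattice, and let $f^1,\dots,f^d$ be the dual basis, $f^i\cdot e^j=2\pi\delta_{ij}$. For $N\in\mathbb N$ put $$\Gamma_N=\Big\{\sum_i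 n_ie^i : n_i\in\mathbb Z,\ |n_i|\le N\Big\},\qquad \Gamma'_N=\Big\{\sum_i n_if^i : n_i\in\mathbb Z,\ |n_i|\le N\Big\},$$ so that $|\Gamma_N|=|\Gamma'_N|=(2N+1)^d$. Let $\mathbb Z_\Gamma\subseteq\mathbb W$ be the $C^*$-subalgebra generated by the elements $u_{\gamma'}v_\gamma$ with $(\gamma,\gamma')\in\Gamma\times\Gamma'$. For a unital $C^*$-algebra $\mathbb A$ let $\mathcal S_{\mathbb A}$ be the set of its states (normalized positive linear functionals) and $\mathcal P_{\mathbb A}$ the set of its pure states (extreme points of $\mathcal S_{\mathbb A}$), both with the topology of pointwise convergence. Let $\mathcal S^{\rm Z}_{\mathbb W}$ be the set of Zak states, i.e. of the states $\omega$ of $\mathbb W$ with $\omega\circ\tau_\gamma\circ\theta_{\gamma'}=\omega$ for all $(\gamma,\gamma')\in\Gamma\times\Gamma'$, and let $\mathcal P^{\rm Z}_{\mathbb W}=\mathcal S^{\rm Z}_{\mathbb W}\cap\mathcal P_{\mathbb W}$ be the set of pure Zak states. Then $\mathbb Z_\Gamma$ is commutative; for every $a\in\mathbb W$ the ergodic mean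 $$\langle a\rangle_{\Gamma\times\Gamma'}=\lim_{N\to\infty}\frac1{|\Gamma_N|^2}\sum_{(\gamma,\gamma')\in\Gamma_N\times\Gamma'_N}\tau_\gamma(\theta_{\gamma'}(a))$$ exists in norm and lies in $\mathbb Z_\Gamma$; and the prescription $$\omega(a)=\widetilde\omega\big(\langle a\rangle_{\Gamma\times\Gamma'}\big),\qquad a\in\mathbb W,$$ defines a homeomorphism $\widetilde\omega\mapsto\omega$ from $\mathcal S_{\mathbb Z_\Gamma}$ onto $\mathcal S^{\rm Z}_{\mathbb W}$, which restricts to a homeomorphism from $\mathcal P_{\mathbb Z_\Gamma}$ onto $\mathcal P^{\rm Z}_{\mathbb W}$. -/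

import Mathlib

open scoped ENNReal ComplexOrder
open Module

noncomputable section

/-- The configuration space `ℝ^d` with its Euclidean scalar product. -/
abbrev RSpace (d : ℕ) : Type := EuclideanSpace ℝ (Fin d)

/-! ### The Weyl C*-algebra -/

/-- A `*`-representation of the Weyl relations (equivalently, a unital `*`-representation of the
`*`-algebra of formal linear combinations of the monomials `u_α v_β`) by bounded operators on a
nonzero Hilbert space `H`. No continuity in `α` or `β` is required. -/
structure WeylSystem (d : ℕ) where
  H : Type
  [normed : NormedAddCommGroup H]
  [innerProduct : InnerProductSpace ℂ H]
  [complete : CompleteSpace H]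
  [nontriv : Nontrivial H]
  U : RSpace d → H →L[ℂ] H
  V : RSpace d → H →L[ℂ] H
  U_zero : U 0 = 1
  V_zero : V 0 = 1
  U_add : ∀ α α', U (α + α') = U α * U α'
  V_add : ∀ β β', V (β + β') = V β * V β'
  U_star : ∀ α, star (U α) = U (-α)
  V_star : ∀ β, star (V β) = V (-β)
  weyl : ∀ α β, U α * V β = Complex.exp (Complex.I * (inner ℝ α β : ℝ)) • (V β * U α)

attribute [instance] WeylSystem.normed WeylSystem.innerProduct WeylSystem.complete
  WeylSystem.nontriv

namespace WeylSystem

variable {d : ℕ}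

lemma norm_U_le (ρ : WeylSystem d) (α : RSpace d) : ‖ρ.U α‖ ≤ 1 := by
  refine (CStarRing.norm_of_mem_unitary ⟨?_, ?_⟩).le <;>
    rw [ρ.U_star, ← ρ.U_add] <;> simp [ρ.U_zero]

lemma norm_V_le (ρ : WeylSystem d) (β : RSpace d) : ‖ρ.V β‖ ≤ 1 := by
  refine (CStarRing.norm_of_mem_unitary ⟨?_, ?_⟩).le <;>
    rw [ρ.V_star, ← ρ.V_add] <;> simp [ρ.V_zero]

end WeylSystem

/-- The C*-algebra of uniformly bounded families `(T_ρ)_ρ` of operators `T_ρ ∈ B(H_ρ)`, indexed by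
all representations `ρ` of the Weyl relations, with the norm `‖T‖ = sup_ρ ‖T_ρ‖`. -/
def WeylProduct (d : ℕ) : Type 1 := lp (fun ρ : WeylSystem d => ρ.H →L[ℂ] ρ.H) ∞

instance (d : ℕ) : CStarAlgebra (WeylProduct d) :=
  let _ : CStarAlgebra (lp (fun ρ : WeylSystem d => ρ.H →L[ℂ] ρ.H) ∞) := { }
  inferInstanceAs (CStarAlgebra (lp (fun ρ : WeylSystem d => ρ.H →L[ℂ] ρ.H) ∞))

/-- The family `(ρ(u_α))_ρ`. -/
def uProduct {d : ℕ} (α : RSpace d) : WeylProduct d :=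
  ⟨fun ρ => ρ.U α, memℓp_infty ⟨1, by rintro _ ⟨ρ, rfl⟩; exact ρ.norm_U_le α⟩⟩

/-- The family `(ρ(v_β))_ρ`. -/
def vProduct {d : ℕ} (β : RSpace d) : WeylProduct d :=
  ⟨fun ρ => ρ.V β, memℓp_infty ⟨1, by rintro _ ⟨ρ, rfl⟩; exact ρ.norm_V_le β⟩⟩

/-- The Weyl C*-algebra as a closed `*`-subalgebra of the product of all representations. The norm
of a finite sum `a = ∑ c_j u_{α_j} v_{β_j}` in it is `sup_ρ ‖ρ(a)‖`, and these sums form a dense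
`*`-subalgebra: it is the completion of the Weyl `*`-algebra for that norm. -/
def weylSubalgebra (d : ℕ) : StarSubalgebra ℂ (WeylProduct d) :=
  (StarAlgebra.adjoin ℂ
    (Set.range (uProduct (d := d)) ∪ Set.range (vProduct (d := d)))).topologicalClosure

instance (d : ℕ) : IsClosed (weylSubalgebra d : Set (WeylProduct d)) :=
  StarSubalgebra.isClosed_topologicalClosure _

/-- The `d`-dimensional Weyl C*-algebra `𝕎`. -/
def WeylAlgebra (d : ℕ) : Type 1 := weylSubalgebra d

instance (d : ℕ) : CStarAlgebra (WeylAlgebra d) :=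
  inferInstanceAs (CStarAlgebra (weylSubalgebra d))

/-- The generator `u_α ∈ 𝕎`. -/
def weylU {d : ℕ} (α : RSpace d) : WeylAlgebra d :=
  ⟨uProduct α, StarSubalgebra.le_topologicalClosure _
    (StarAlgebra.subset_adjoin ℂ _ (Or.inl ⟨α, rfl⟩))⟩

/-- The generator `v_β ∈ 𝕎`. -/
def weylV {d : ℕ} (β : RSpace d) : WeylAlgebra d :=
  ⟨vProduct β, StarSubalgebra.le_topologicalClosure _
    (StarAlgebra.subset_adjoin ℂ _ (Or.inr ⟨β, rfl⟩))⟩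

/-- The representation of `𝕎` extending `ρ`. -/
def WeylSystem.rep {d : ℕ} (ρ : WeylSystem d) (a : WeylAlgebra d) : ρ.H →L[ℂ] ρ.H :=
  (Subtype.val (Subtype.val a) : ∀ ρ : WeylSystem d, ρ.H →L[ℂ] ρ.H) ρ

/-- The norm of `𝕎` is the supremum of the operator norms over all representations. -/
lemma weyl_norm_eq {d : ℕ} (a : WeylAlgebra d) : ‖a‖ = ⨆ ρ : WeylSystem d, ‖ρ.rep a‖ :=
  lp.norm_eq_ciSup _

/-- Space translations `τ_λ(a) = v_λ a v_λ^*`. -/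
def spaceTranslation {d : ℕ} (x : RSpace d) (a : WeylAlgebra d) : WeylAlgebra d :=
  weylV x * a * star (weylV x)

/-- Momentum translations `θ_α(a) = u_α a u_α^*`. -/
def momentumTranslation {d : ℕ} (α : RSpace d) (a : WeylAlgebra d) : WeylAlgebra d :=
  weylU α * a * star (weylU α)

/-! ### States -/

/-- The state space of a unital C*-algebra: normalized positive linear functionals (these are
automatically continuous), with the topology of pointwise convergence. -/
def stateSpace (A : Type*) [CStarAlgebra A] : Set (WeakDual ℂ A) :=
  {ω | ω 1 = 1 ∧ ∀ a : A, 0 ≤ ω (star a * a)}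

/-- The pure states: the extreme points of the state space. -/
def pureStates (A : Type*) [CStarAlgebra A] : Set (WeakDual ℂ A) :=
  (stateSpace A).extremePoints ℝ

/-! ### Lattices -/

/-- The lattice `Γ` of integer combinations of a basis of `ℝ^d`. -/
def lattice {d : ℕ} (e : Basis (Fin d) ℝ (RSpace d)) : Set (RSpace d) :=
  {γ | ∃ n : Fin d → ℤ, γ = ∑ i, n i • e i}

/-- The dual lattice `Γ' = {γ' | γ' · γ ∈ 2πℤ for all γ ∈ Γ}`. -/
def dualLattice {d : ℕ} (e : Basis (Fin d) ℝ (RSpace d)) : Set (RSpace d) :=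
  {γ' | ∀ γ ∈ lattice e, ∃ n : ℤ, inner ℝ γ' γ = 2 * Real.pi * n}

lemma innerForm_nondegenerate (d : ℕ) :
    LinearMap.BilinForm.Nondegenerate (innerₗ (RSpace d) : LinearMap.BilinForm ℝ (RSpace d)) := by
  refine ⟨fun x hx => ?_, fun x hx => ?_⟩ <;>
  · have := hx x
    simpa using this

/-- The dual basis `f^1, …, f^d`, characterized by `f^i · e^j = 2π δ_{ij}`. -/
def dualLatticeBasis {d : ℕ} (e : Basis (Fin d) ℝ (RSpace d)) : Basis (Fin d) ℝ (RSpace d) :=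
  (LinearMap.BilinForm.dualBasis (innerₗ (RSpace d)) (innerForm_nondegenerate d) e).unitsSMul
    fun _ => Units.mk0 (2 * Real.pi) Real.two_pi_pos.ne'

lemma inner_dualLatticeBasis {d : ℕ} (e : Basis (Fin d) ℝ (RSpace d)) (i j : Fin d) :
    inner ℝ (dualLatticeBasis e i) (e j) = if j = i then 2 * Real.pi else 0 := by
  have h := LinearMap.BilinForm.apply_dualBasis_left (innerForm_nondegenerate d) e i j
  rw [innerₗ_apply_apply] at h
  rw [dualLatticeBasis, Basis.unitsSMul_apply, Units.smul_def, Units.val_mk0,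
    real_inner_smul_left, h]
  split <;> simp

/-- The points of the lattice of `e` whose coordinates in the basis `e` have absolute value at most
`N`; there are `(2N+1)^d` of them. -/
def latticeBox {d : ℕ} (e : Basis (Fin d) ℝ (RSpace d)) (N : ℕ) : Finset (RSpace d) :=
  open Classical in
  (Fintype.piFinset fun _ : Fin d => Finset.Icc (-(N : ℤ)) N).image fun n => ∑ i, n i • e i

/-! ### Zak states -/

/-- The C*-subalgebra of `𝕎` generated by the `u_{γ'} v_γ`, `γ ∈ Γ`, `γ' ∈ Γ'`. -/
def zakSubalgebra {d : ℕ} (e : Basis (Fin d) ℝ (RSpace d)) : StarSubalgebra ℂ (WeylAlgebra d) :=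
  (StarAlgebra.adjoin ℂ
    {a | ∃ γ ∈ lattice e, ∃ γ' ∈ dualLattice e, a = weylU γ' * weylV γ}).topologicalClosure

instance {d : ℕ} (e : Basis (Fin d) ℝ (RSpace d)) :
    IsClosed (zakSubalgebra e : Set (WeylAlgebra d)) :=
  StarSubalgebra.isClosed_topologicalClosure _

/-- The Zak states: states of `𝕎` with `ω ∘ τ_γ ∘ θ_{γ'} = ω` for all `γ ∈ Γ`, `γ' ∈ Γ'`. -/
def zakStates {d : ℕ} (e : Basis (Fin d) ℝ (RSpace d)) : Set (WeakDual ℂ (WeylAlgebra d)) :=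
  {ω | ω ∈ stateSpace (WeylAlgebra d) ∧ ∀ γ ∈ lattice e, ∀ γ' ∈ dualLattice e,
    ∀ a : WeylAlgebra d, ω (spaceTranslation γ (momentumTranslation γ' a)) = ω a}

/-- The Zak states that are pure states of `𝕎`. -/
def pureZakStates {d : ℕ} (e : Basis (Fin d) ℝ (RSpace d)) : Set (WeakDual ℂ (WeylAlgebra d)) :=
  zakStates e ∩ pureStates (WeylAlgebra d)

/-- The partial averages
`(2N+1)^{-2d} ∑_{γ ∈ Γ_N} ∑_{γ' ∈ Γ'_N} τ_γ(θ_{γ'}(a))`. -/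
def zakAverage {d : ℕ} (e : Basis (Fin d) ℝ (RSpace d)) (N : ℕ) (a : WeylAlgebra d) :
    WeylAlgebra d :=
  (1 / (((2 * N + 1) ^ d) ^ 2 : ℂ)) •
    ∑ γ ∈ latticeBox e N, ∑ γ' ∈ latticeBox (dualLatticeBasis e) N,
      spaceTranslation γ (momentumTranslation γ' a)

/-- `m` is the `Γ × Γ'`-ergodic mean of `a`: the norm limit of the partial averages. -/
def IsZakMean {d : ℕ} (e : Basis (Fin d) ℝ (RSpace d)) (a m : WeylAlgebra d) : Prop :=
  Filter.Tendsto (fun N : ℕ => zakAverage e N a) Filter.atTop (nhds m)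

end

/-! Each monomial `u_α v_β` is a joint eigenvector of the translations `τ_γ ∘ θ_{γ'}`, with
eigenvalue a character of `(γ, γ')` (`translation_weylUV`). The mean of a character over growing
boxes is 1 if the character is trivial and 0 otherwise (`tendsto_mean_phase`). So averaging keeps
exactly the monomials with `(β, α) ∈ Γ × Γ'` and kills the others. The averages are contractions and
the monomials span a dense subspace, so the mean exists everywhere and maps into `ℤ_Γ`, which is
commutative because its commutation phases are trivial.

The mean is unital, positive, translation invariant and the identity on `ℤ_Γ`; an invariant state
takes the same value on `a` and on its mean. Hence composing with the mean and restricting to `ℤ_Γ`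
are mutually inverse, weak-* continuous and affine.

For pure states, a decomposition of a state of `ℤ_Γ` lifts through the mean, so a pure Zak state
restricts to a pure state. Conversely, let a Zak state restrict to a pure state. The components of
any decomposition of it in `𝕎` restrict to this same pure state, but need not be invariant a priori.
They are: a pure state of a commutative algebra has modulus one on unitaries
(`pureStates.norm_apply_unitary`), and by Cauchy–Schwarz this forces invariance under conjugation by
them (`stateSpace.apply_conj`). So the components are Zak states with the same restriction, hence
equal. -/

/-! ### The Weyl relations in `𝕎` -/

section WeylRelations

variable {d : ℕ}

/-- The scalar `e^{it}`. -/
noncomputable def phase (t : ℝ) : ℂ := Complex.exp (Complex.I * t)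

lemma phase_zero : phase 0 = 1 := by simp [phase]

lemma phase_add (s t : ℝ) : phase (s + t) = phase s * phase t := by
  simp [phase, mul_add, Complex.exp_add]

lemma norm_phase (t : ℝ) : ‖phase t‖ = 1 := by
  rw [phase, mul_comm, Complex.norm_exp_ofReal_mul_I]

lemma phase_neg_mul (t : ℝ) : phase (-t) * phase t = 1 := by
  rw [← phase_add, neg_add_cancel, phase_zero]

lemma phase_int_mul (n : ℤ) (t : ℝ) : phase (n * t) = phase t ^ n := by
  rw [phase, phase, ← Complex.exp_int_mul]
  push_cast
  ring_nf

lemma phase_sum {ι : Type*} (s : Finset ι) (t : ι → ℝ) :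
    phase (∑ i ∈ s, t i) = ∏ i ∈ s, phase (t i) := by
  simp [phase, Finset.mul_sum, Complex.exp_sum]

lemma phase_eq_one_iff (t : ℝ) : phase t = 1 ↔ ∃ n : ℤ, t = 2 * Real.pi * n := by
  rw [phase, Complex.exp_eq_one_iff]
  refine exists_congr fun n => ?_
  rw [show (n : ℂ) * (2 * Real.pi * Complex.I) = Complex.I * ((2 * Real.pi * n : ℝ) : ℂ) by
    push_cast; ring, mul_right_inj' Complex.I_ne_zero, Complex.ofReal_inj]

lemma uProduct_zero : uProduct (0 : RSpace d) = 1 :=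
  Subtype.ext (funext fun ρ => ρ.U_zero)

lemma vProduct_zero : vProduct (0 : RSpace d) = 1 :=
  Subtype.ext (funext fun ρ => ρ.V_zero)

lemma uProduct_add (α β : RSpace d) : uProduct (α + β) = uProduct α * uProduct β :=
  Subtype.ext (funext fun ρ => ρ.U_add α β)

lemma vProduct_add (α β : RSpace d) : vProduct (α + β) = vProduct α * vProduct β :=
  Subtype.ext (funext fun ρ => ρ.V_add α β)

lemma star_uProduct (α : RSpace d) : star (uProduct α) = uProduct (-α) :=
  Subtype.ext (funext fun ρ => ρ.U_star α)

lemma star_vProduct (α : RSpace d) : star (vProduct α) = vProduct (-α) :=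
  Subtype.ext (funext fun ρ => ρ.V_star α)

lemma uProduct_mul_vProduct (α β : RSpace d) :
    uProduct α * vProduct β = phase (inner ℝ α β) • (vProduct β * uProduct α) :=
  Subtype.ext (funext fun ρ => ρ.weyl α β)

lemma weylU_zero : weylU (0 : RSpace d) = 1 := Subtype.ext uProduct_zero

lemma weylV_zero : weylV (0 : RSpace d) = 1 := Subtype.ext vProduct_zero

lemma weylU_add (α β : RSpace d) : weylU (α + β) = weylU α * weylU β :=
  Subtype.ext (uProduct_add α β)

lemma weylV_add (α β : RSpace d) : weylV (α + β) = weylV α * weylV β :=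
  Subtype.ext (vProduct_add α β)

lemma star_weylU (α : RSpace d) : star (weylU α) = weylU (-α) := Subtype.ext (star_uProduct α)

lemma star_weylV (α : RSpace d) : star (weylV α) = weylV (-α) := Subtype.ext (star_vProduct α)

lemma weylU_mul_weylV (α β : RSpace d) :
    weylU α * weylV β = phase (inner ℝ α β) • (weylV β * weylU α) :=
  Subtype.ext (uProduct_mul_vProduct α β)

lemma weylV_mul_weylU (β α : RSpace d) :
    weylV β * weylU α = phase (-inner ℝ α β) • (weylU α * weylV β) := by
  rw [weylU_mul_weylV, smul_smul, phase_neg_mul, one_smul]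

lemma vProduct_mul_uProduct (β α : RSpace d) :
    vProduct β * uProduct α = phase (-inner ℝ α β) • (uProduct α * vProduct β) := by
  rw [uProduct_mul_vProduct, smul_smul, phase_neg_mul, one_smul]

/-- Products of monomials are multiples of monomials. -/
lemma uvProduct_mul_uvProduct (α β α' β' : RSpace d) :
    (uProduct α * vProduct β) * (uProduct α' * vProduct β')
      = phase (-inner ℝ α' β) • (uProduct (α + α') * vProduct (β + β')) := by
  calc _ = uProduct α * (vProduct β * uProduct α') * vProduct β' := by simp only [mul_assoc]
    _ = _ := by
      rw [vProduct_mul_uProduct, uProduct_add, vProduct_add]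
      simp only [mul_smul_comm, smul_mul_assoc, mul_assoc]

lemma weylUV_mul_weylUV (α β α' β' : RSpace d) :
    (weylU α * weylV β) * (weylU α' * weylV β')
      = phase (-inner ℝ α' β) • (weylU (α + α') * weylV (β + β')) :=
  Subtype.ext (uvProduct_mul_uvProduct α β α' β')

lemma weylU_mem_unitary (α : RSpace d) : weylU α ∈ unitary (WeylAlgebra d) := by
  constructor <;> rw [star_weylU, ← weylU_add] <;> simp [weylU_zero]

lemma weylV_mem_unitary (α : RSpace d) : weylV α ∈ unitary (WeylAlgebra d) := by
  constructor <;> rw [star_weylV, ← weylV_add] <;> simp [weylV_zero]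

/-- Scalar multiples of monomials are closed under products and contain the generators and their
adjoints, so no further elements arise. -/
lemma adjoin_uProduct_vProduct_le_span :
    (StarAlgebra.adjoin ℂ
      (Set.range (uProduct (d := d)) ∪ Set.range (vProduct (d := d)))).toSubalgebra.toSubmodule ≤
    Submodule.span ℂ (Set.range fun p : RSpace d × RSpace d => uProduct p.1 * vProduct p.2) := by
  rw [StarAlgebra.adjoin_eq_span, Submodule.span_le]
  intro x hx
  suffices h : ∃ (c : ℂ) (α β : RSpace d), x = c • (uProduct α * vProduct β) by
    obtain ⟨c, α, β, rfl⟩ := h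
    exact Submodule.smul_mem _ _ (Submodule.subset_span ⟨(α, β), rfl⟩)
  induction hx using Submonoid.closure_induction with
  | mem x hx =>
    have key : ∀ y ∈ Set.range (uProduct (d := d)) ∪ Set.range (vProduct (d := d)),
        ∃ (c : ℂ) (α β : RSpace d), y = c • (uProduct α * vProduct β) := by
      rintro _ (⟨α, rfl⟩ | ⟨β, rfl⟩)
      · exact ⟨1, α, 0, by rw [vProduct_zero, mul_one, one_smul]⟩
      · exact ⟨1, 0, β, by rw [uProduct_zero, one_mul, one_smul]⟩
    rcases hx with hx | hx
    · exact key x hx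
    · refine key x ?_
      rw [Set.mem_star] at hx
      rcases hx with ⟨α, h⟩ | ⟨α, h⟩
      · exact Or.inl ⟨-α, by rw [← star_uProduct, h, star_star]⟩
      · exact Or.inr ⟨-α, by rw [← star_vProduct, h, star_star]⟩
  | one => exact ⟨1, 0, 0, by rw [uProduct_zero, vProduct_zero, mul_one, one_smul]⟩
  | mul x y _ _ hx hy =>
    obtain ⟨c, α, β, rfl⟩ := hx
    obtain ⟨c', α', β', rfl⟩ := hy
    exact ⟨c * c' * phase (-inner ℝ α' β), α + α', β + β', by
      rw [smul_mul_smul_comm, uvProduct_mul_uvProduct, smul_smul]⟩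

/-- The linear combinations of the monomials `u_α v_β` are dense in `𝕎`. -/
lemma dense_span_weylUV :
    Dense (Submodule.span ℂ
      (Set.range fun p : RSpace d × RSpace d => weylU p.1 * weylV p.2) : Set (WeylAlgebra d)) := by
  let f : WeylAlgebra d →ₗ[ℂ] WeylProduct d := (weylSubalgebra d).toSubalgebra.toSubmodule.subtype
  have hf : Topology.IsInducing f := Topology.IsInducing.subtypeVal
  intro a
  -- Density in `𝕎` is tested in the ambient product, where `𝕎` is defined as a closure.
  rw [hf.closure_eq_preimage_closure_image]
  have hspan : f '' (Submodule.span ℂ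
      (Set.range fun p : RSpace d × RSpace d => weylU p.1 * weylV p.2) : Set (WeylAlgebra d)) =
      Submodule.span ℂ (Set.range fun p : RSpace d × RSpace d => uProduct p.1 * vProduct p.2) := by
    rw [← Submodule.map_coe, Submodule.map_span, ← Set.range_comp]
    rfl
  rw [hspan]
  exact closure_mono adjoin_uProduct_vProduct_le_span a.2

end WeylRelations

/-! ### Lattices and characters -/

section Lattices

variable {d : ℕ}

lemma sum_latticeBox {M : Type*} [AddCommMonoid M] (e : Basis (Fin d) ℝ (RSpace d)) (N : ℕ)
    (f : RSpace d → M) :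
    ∑ γ ∈ latticeBox e N, f γ =
      ∑ n ∈ Fintype.piFinset fun _ : Fin d => Finset.Icc (-(N : ℤ)) N, f (∑ i, n i • e i) := by
  classical
  rw [latticeBox, Finset.sum_image]
  intro n _ m _ h
  funext i
  have h' := congrArg (fun x => e.repr x i) h
  simpa [← Int.cast_smul_eq_zsmul ℝ, Finsupp.single_apply] using h'

lemma card_latticeBox (e : Basis (Fin d) ℝ (RSpace d)) (N : ℕ) :
    (latticeBox e N).card = (2 * N + 1) ^ d := by
  rw [Finset.card_eq_sum_ones, sum_latticeBox, ← Finset.card_eq_sum_ones, Fintype.card_piFinset]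
  simp only [Int.card_Icc, Finset.prod_const, Finset.card_univ, Fintype.card_fin]
  congr 1
  omega

lemma neg_mem_lattice {e : Basis (Fin d) ℝ (RSpace d)} {γ : RSpace d} (h : γ ∈ lattice e) :
    -γ ∈ lattice e := by
  obtain ⟨n, rfl⟩ := h
  exact ⟨-n, by simp⟩

lemma neg_mem_dualLattice {e : Basis (Fin d) ℝ (RSpace d)} {γ : RSpace d}
    (h : γ ∈ dualLattice e) : -γ ∈ dualLattice e := by
  intro δ hδ
  obtain ⟨n, hn⟩ := h δ hδ
  exact ⟨-n, by rw [inner_neg_left, hn]; push_cast; ring⟩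

lemma phase_inner_eq_one {e : Basis (Fin d) ℝ (RSpace d)} {γ γ' : RSpace d} (h : γ ∈ lattice e)
    (h' : γ' ∈ dualLattice e) : phase (inner ℝ γ' γ) = 1 :=
  (phase_eq_one_iff _).2 (h' γ h)

lemma latticeBox_subset_lattice (e : Basis (Fin d) ℝ (RSpace d)) (N : ℕ) {γ : RSpace d}
    (h : γ ∈ latticeBox e N) : γ ∈ lattice e := by
  classical
  obtain ⟨n, -, rfl⟩ := Finset.mem_image.1 h
  exact ⟨n, rfl⟩

lemma mem_dualLattice_iff (e : Basis (Fin d) ℝ (RSpace d)) (x : RSpace d) :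
    x ∈ dualLattice e ↔ ∀ i, ∃ n : ℤ, inner ℝ x (e i) = 2 * Real.pi * n := by
  constructor
  · intro h i
    exact h _ ⟨Pi.single i 1, by simp [Pi.single_apply, ite_smul]⟩
  · rintro h _ ⟨m, rfl⟩
    choose n hn using h
    refine ⟨∑ i, m i * n i, ?_⟩
    simp only [inner_sum, ← Int.cast_smul_eq_zsmul ℝ, inner_smul_right, hn]
    push_cast
    rw [Finset.mul_sum]
    exact Finset.sum_congr rfl fun i _ => by ring

lemma inner_dualLatticeBasis_right (e : Basis (Fin d) ℝ (RSpace d)) (x : RSpace d) (i : Fin d) :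
    inner ℝ x (dualLatticeBasis e i) = 2 * Real.pi * e.repr x i := by
  conv_lhs => rw [real_inner_comm, ← e.sum_repr x]
  simp only [inner_sum, real_inner_smul_right, inner_dualLatticeBasis]
  simp [mul_comm]

/-- Pairing with the dual basis reads off coordinates up to the factor `2π`. This is the criterion
of `mem_dualLattice_iff` for the dual basis, whence biduality. -/
lemma mem_lattice_iff (e : Basis (Fin d) ℝ (RSpace d)) (x : RSpace d) :
    x ∈ lattice e ↔ ∀ i, ∃ n : ℤ, inner ℝ x (dualLatticeBasis e i) = 2 * Real.pi * n := by
  simp only [inner_dualLatticeBasis_right, mul_right_inj' Real.two_pi_pos.ne']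
  constructor
  · rintro ⟨n, rfl⟩ i
    exact ⟨n i, by simp [← Int.cast_smul_eq_zsmul ℝ, Finsupp.single_apply]⟩
  · intro h
    choose n hn using h
    refine ⟨n, ?_⟩
    conv_lhs => rw [← e.sum_repr x]
    simp only [hn, Int.cast_smul_eq_zsmul]

lemma dualLattice_dualLatticeBasis (e : Basis (Fin d) ℝ (RSpace d)) :
    dualLattice (dualLatticeBasis e) = lattice e := by
  ext x
  rw [mem_dualLattice_iff, mem_lattice_iff]

lemma dualLatticeBox_subset_dualLattice (e : Basis (Fin d) ℝ (RSpace d)) (N : ℕ) {γ : RSpace d}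
    (h : γ ∈ latticeBox (dualLatticeBasis e) N) : γ ∈ dualLattice e := by
  classical
  obtain ⟨n, -, rfl⟩ := Finset.mem_image.1 h
  rw [mem_dualLattice_iff]
  intro i
  refine ⟨n i, ?_⟩
  simp only [sum_inner, ← Int.cast_smul_eq_zsmul ℝ, inner_smul_left, inner_dualLatticeBasis]
  simp [mul_comm]

/-- Telescoping of the geometric sum. -/
lemma sub_one_mul_sum_Icc_zpow {z : ℂ} (hz : z ≠ 0) (N : ℕ) :
    (z - 1) * ∑ n ∈ Finset.Icc (-(N : ℤ)) N, z ^ n = z ^ ((N : ℤ) + 1) - z ^ (-(N : ℤ)) := by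
  induction N with
  | zero => simp
  | succ N ih =>
    have h : Finset.Icc (-((N + 1 : ℕ) : ℤ)) ((N + 1 : ℕ) : ℤ) =
        Finset.Icc (-(N : ℤ)) N ∪ {-((N : ℤ) + 1), (N : ℤ) + 1} := by
      ext x
      simp only [Finset.mem_Icc, Finset.mem_union, Finset.mem_insert, Finset.mem_singleton]
      omega
    rw [h, Finset.sum_union (by simp), Finset.sum_pair (by omega), mul_add, ih]
    have h1 : z ^ (-(N : ℤ)) = z ^ (-((N : ℤ) + 1)) * z := by
      rw [← zpow_add_one₀ hz]; congr 1; ring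
    have h2 : z ^ (((N + 1 : ℕ) : ℤ) + 1) = z ^ ((N : ℤ) + 1) * z := by
      rw [← zpow_add_one₀ hz]; congr 1
    rw [h1, h2]
    push_cast
    ring

/-- For `z ≠ 1` on the unit circle the symmetric geometric sums stay below `2 / ‖z - 1‖`, so
dividing by `2N + 1` sends them to 0. -/
lemma tendsto_mean_zpow {z : ℂ} (hz : ‖z‖ = 1) :
    Filter.Tendsto (fun N : ℕ => (2 * N + 1 : ℂ)⁻¹ * ∑ n ∈ Finset.Icc (-(N : ℤ)) N, z ^ n)
      Filter.atTop (nhds (if z = 1 then 1 else 0)) := by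
  have hz0 : z ≠ 0 := by rintro rfl; simp at hz
  split_ifs with h
  · refine tendsto_const_nhds.congr fun N => ?_
    have hN : (2 * N + 1 : ℂ) ≠ 0 := by exact_mod_cast (2 * N).succ_ne_zero
    have hc : ((N : ℤ) + 1 - -(N : ℤ)).toNat = 2 * N + 1 := by omega
    simp only [h, one_zpow, Finset.sum_const, Int.card_Icc, hc, nsmul_eq_mul, mul_one]
    push_cast
    exact (inv_mul_cancel₀ hN).symm
  · have hz1 : 0 < ‖z - 1‖ := norm_pos_iff.2 (sub_ne_zero.2 h)
    have hbound : ∀ N : ℕ, ‖∑ n ∈ Finset.Icc (-(N : ℤ)) N, z ^ n‖ ≤ 2 / ‖z - 1‖ := by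
      intro N
      rw [le_div_iff₀' hz1, ← norm_mul, sub_one_mul_sum_Icc_zpow hz0]
      refine (norm_sub_le _ _).trans ?_
      simp only [norm_zpow, hz, one_zpow]
      norm_num
    have hlim : Filter.Tendsto (fun N : ℕ => (2 * N + 1 : ℂ)⁻¹) Filter.atTop (nhds 0) := by
      have h2 : Filter.Tendsto (fun N : ℕ => ((2 * N + 1 : ℕ) : ℂ)⁻¹) Filter.atTop (nhds 0) :=
        (tendsto_inv_atTop_nhds_zero_nat (𝕜 := ℂ)).comp
          (Filter.tendsto_atTop_mono (fun N => by simp only [id]; omega) Filter.tendsto_id)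
      simpa using h2
    refine squeeze_zero_norm (a := fun N : ℕ => ‖(2 * N + 1 : ℂ)⁻¹‖ * (2 / ‖z - 1‖))
      (fun N => ?_) ?_
    · rw [norm_mul]
      exact mul_le_mul_of_nonneg_left (hbound N) (norm_nonneg _)
    · simpa using hlim.norm.mul_const (2 / ‖z - 1‖)

lemma sum_phase_latticeBox (e : Basis (Fin d) ℝ (RSpace d)) (N : ℕ) (x : RSpace d) :
    ∑ γ ∈ latticeBox e N, phase (inner ℝ x γ) =
      ∏ i, ∑ n ∈ Finset.Icc (-(N : ℤ)) N, phase (inner ℝ x (e i)) ^ n := by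
  rw [sum_latticeBox, Finset.prod_univ_sum]
  refine Finset.sum_congr rfl fun n _ => ?_
  rw [inner_sum, phase_sum]
  refine Finset.prod_congr rfl fun i _ => ?_
  rw [← Int.cast_smul_eq_zsmul ℝ, real_inner_smul_right, phase_int_mul]

open Classical in
/-- The mean of a character over the boxes of a lattice. -/
lemma tendsto_mean_phase (e : Basis (Fin d) ℝ (RSpace d)) (x : RSpace d) :
    Filter.Tendsto (fun N : ℕ => ((2 * N + 1 : ℂ) ^ d)⁻¹ *
      ∑ γ ∈ latticeBox e N, phase (inner ℝ x γ)) Filter.atTop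
      (nhds (if ∀ i, ∃ n : ℤ, inner ℝ x (e i) = 2 * Real.pi * n then 1 else 0)) := by
  have h := tendsto_finsetProd (Finset.univ : Finset (Fin d)) fun i _ =>
    tendsto_mean_zpow (norm_phase (inner ℝ x (e i)))
  simp only [phase_eq_one_iff, Finset.prod_ite_zero, Finset.prod_const_one, Finset.mem_univ,
    true_implies] at h
  refine h.congr fun N => ?_
  rw [sum_phase_latticeBox, Finset.prod_mul_distrib]
  simp

end Lattices

/-! ### The ergodic mean -/

section Mean

variable {d : ℕ}

/-- Conjugation by a single unitary, which belongs to `ℤ_Γ` for lattice points: isometry, positivity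
and invariance are all read off this form. -/
lemma translation_eq (γ γ' : RSpace d) (a : WeylAlgebra d) :
    spaceTranslation γ (momentumTranslation γ' a)
      = (weylV γ * weylU γ') * a * star (weylV γ * weylU γ') := by
  simp only [spaceTranslation, momentumTranslation, star_mul, mul_assoc]

lemma weylVU_mem_unitary (γ γ' : RSpace d) : weylV γ * weylU γ' ∈ unitary (WeylAlgebra d) :=
  mul_mem (weylV_mem_unitary γ) (weylU_mem_unitary γ')

lemma translation_weylUV (γ γ' α β : RSpace d) :
    spaceTranslation γ (momentumTranslation γ' (weylU α * weylV β))
      = (phase (inner ℝ (-α) γ) * phase (inner ℝ β γ')) • (weylU α * weylV β) := by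
  have h1 : momentumTranslation γ' (weylU α * weylV β)
      = phase (inner ℝ β γ') • (weylU α * weylV β) := by
    calc _ = weylU γ' * weylU α * (weylV β * weylU (-γ')) := by
          rw [momentumTranslation, star_weylU]; simp only [mul_assoc]
      _ = _ := by
          rw [weylV_mul_weylU, mul_smul_comm, inner_neg_left, neg_neg, real_inner_comm,
            ← weylU_add, ← mul_assoc, ← weylU_add]
          congr 3
          abel
  have h2 : spaceTranslation γ (weylU α * weylV β)
      = phase (inner ℝ (-α) γ) • (weylU α * weylV β) := by
    calc _ = weylV γ * weylU α * (weylV β * weylV (-γ)) := by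
          rw [spaceTranslation, star_weylV]; simp only [mul_assoc]
      _ = _ := by
          rw [weylV_mul_weylU, smul_mul_assoc, inner_neg_left, ← weylV_add, mul_assoc,
            ← weylV_add]
          congr 3
          abel
  rw [h1, spaceTranslation, mul_smul_comm, smul_mul_assoc, ← spaceTranslation, h2, smul_smul,
    mul_comm]

lemma norm_translation (γ γ' : RSpace d) (a : WeylAlgebra d) :
    ‖spaceTranslation γ (momentumTranslation γ' a)‖ = ‖a‖ := by
  rw [translation_eq, CStarRing.norm_mul_mem_unitary _
    (Unitary.star_mem (weylVU_mem_unitary γ γ')),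
    CStarRing.norm_mem_unitary_mul _ (weylVU_mem_unitary γ γ')]

/-- The partial averages as linear maps. -/
noncomputable def zakAverageLinear (e : Basis (Fin d) ℝ (RSpace d)) (N : ℕ) :
    WeylAlgebra d →ₗ[ℂ] WeylAlgebra d where
  toFun := zakAverage e N
  map_add' a b := by
    simp only [zakAverage, translation_eq, mul_add, add_mul, Finset.sum_add_distrib, smul_add]
  map_smul' c a := by
    simp only [zakAverage, translation_eq, mul_smul_comm, smul_mul_assoc, ← Finset.smul_sum,
      RingHom.id_apply]
    rw [smul_comm]

lemma zakAverageLinear_apply (e : Basis (Fin d) ℝ (RSpace d)) (N : ℕ) (a : WeylAlgebra d) :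
    zakAverageLinear e N a = zakAverage e N a := rfl

lemma box_count_ne_zero (d N : ℕ) : (((2 * N + 1) ^ d) ^ 2 : ℂ) ≠ 0 := by
  exact_mod_cast (by positivity : ((2 * N + 1) ^ d) ^ 2 ≠ 0)

/-- Stated for a general module because it serves both for elements of `𝕎` and for values of a
state. -/
lemma average_const (e : Basis (Fin d) ℝ (RSpace d)) (N : ℕ) {M : Type*}
    [AddCommGroup M] [Module ℂ M] (x : M) :
    (1 / (((2 * N + 1) ^ d) ^ 2 : ℂ)) •
      ∑ _γ ∈ latticeBox e N, ∑ _γ' ∈ latticeBox (dualLatticeBasis e) N, x = x := by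
  simp only [Finset.sum_const, card_latticeBox, ← Nat.cast_smul_eq_nsmul ℂ, smul_smul]
  have h := box_count_ne_zero d N
  push_cast
  rw [← sq, one_div_mul_cancel h, one_smul]

lemma norm_zakAverage_le (e : Basis (Fin d) ℝ (RSpace d)) (N : ℕ) (a : WeylAlgebra d) :
    ‖zakAverage e N a‖ ≤ ‖a‖ := by
  have h : ‖∑ γ ∈ latticeBox e N, ∑ γ' ∈ latticeBox (dualLatticeBasis e) N,
      spaceTranslation γ (momentumTranslation γ' a)‖ ≤ ((2 * N + 1) ^ d) ^ 2 * ‖a‖ := by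
    refine (norm_sum_le_of_le _ fun γ _ => norm_sum_le_of_le _ fun γ' _ =>
      (norm_translation γ γ' a).le).trans_eq ?_
    simp only [Finset.sum_const, card_latticeBox, nsmul_eq_mul]
    push_cast
    ring
  have hn : ‖(1 / (((2 * N + 1) ^ d) ^ 2 : ℂ))‖ = (((2 * N + 1) ^ d) ^ 2 : ℝ)⁻¹ := by
    rw [norm_div, norm_one, norm_pow, norm_pow, one_div]
    congr 3
    exact_mod_cast Complex.norm_natCast (2 * N + 1)
  rw [zakAverage, norm_smul, hn]
  refine (mul_le_mul_of_nonneg_left h (by positivity)).trans_eq ?_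
  rw [inv_mul_cancel_left₀ (by positivity)]

-- The averaged eigenvalue factors into a character mean over `Γ_N`, which tests `α` against `Γ`,
-- and one over `Γ'_N`, which tests `β` against `Γ'`; biduality turns the latter into `β ∈ Γ`.
open Classical in
lemma isZakMean_weylUV (e : Basis (Fin d) ℝ (RSpace d)) (α β : RSpace d) :
    IsZakMean e (weylU α * weylV β)
      (if β ∈ lattice e ∧ α ∈ dualLattice e then weylU α * weylV β else 0) := by
  have h := ((tendsto_mean_phase e (-α)).mul (tendsto_mean_phase (dualLatticeBasis e) β)).smul_const
    (weylU α * weylV β)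
  have hα : -α ∈ dualLattice e ↔ α ∈ dualLattice e :=
    ⟨fun h => by simpa using neg_mem_dualLattice h, neg_mem_dualLattice⟩
  simp only [← mem_dualLattice_iff, hα, dualLattice_dualLatticeBasis] at h
  have hl : (if β ∈ lattice e ∧ α ∈ dualLattice e then weylU α * weylV β else 0) =
      ((if α ∈ dualLattice e then 1 else 0 : ℂ) * if β ∈ lattice e then 1 else 0) •
        (weylU α * weylV β) := by
    by_cases h1 : β ∈ lattice e <;> by_cases h2 : α ∈ dualLattice e <;> simp [h1, h2]
  rw [hl, IsZakMean]
  refine h.congr fun N => ?_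
  simp only [zakAverage, translation_weylUV, ← Finset.sum_smul, smul_smul, ← Finset.mul_sum,
    ← Finset.sum_mul]
  congr 1
  field_simp

lemma weylUV_mem_zakSubalgebra {e : Basis (Fin d) ℝ (RSpace d)} {γ γ' : RSpace d}
    (h : γ ∈ lattice e) (h' : γ' ∈ dualLattice e) : weylU γ' * weylV γ ∈ zakSubalgebra e :=
  StarSubalgebra.le_topologicalClosure _ (StarAlgebra.subset_adjoin ℂ _ ⟨γ, h, γ', h', rfl⟩)

lemma weylVU_mem_zakSubalgebra {e : Basis (Fin d) ℝ (RSpace d)} {γ γ' : RSpace d}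
    (h : γ ∈ lattice e) (h' : γ' ∈ dualLattice e) : weylV γ * weylU γ' ∈ zakSubalgebra e := by
  have := weylUV_mem_zakSubalgebra h h'
  rwa [weylU_mul_weylV, phase_inner_eq_one h h', one_smul] at this

/-- Every element of `𝕎` has an ergodic mean, which lies in `ℤ_Γ`. -/
lemma exists_isZakMean (e : Basis (Fin d) ℝ (RSpace d)) (a : WeylAlgebra d) :
    ∃ m ∈ zakSubalgebra e, IsZakMean e a m := by
  classical
  have hspan : ∀ b ∈ Submodule.span ℂ
      (Set.range fun p : RSpace d × RSpace d => weylU p.1 * weylV p.2),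
      ∃ m ∈ zakSubalgebra e, IsZakMean e b m := by
    intro b hb
    induction hb using Submodule.span_induction with
    | mem x hx =>
      obtain ⟨⟨α, β⟩, rfl⟩ := hx
      refine ⟨_, ?_, isZakMean_weylUV e α β⟩
      split_ifs with h
      · exact weylUV_mem_zakSubalgebra h.1 h.2
      · exact zero_mem _
    | zero =>
      exact ⟨0, zero_mem _, tendsto_const_nhds.congr fun N =>
        ((zakAverageLinear e N).map_zero).symm⟩
    | add x y _ _ hx hy =>
      obtain ⟨m, hm, hx⟩ := hx
      obtain ⟨n, hn, hy⟩ := hy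
      exact ⟨m + n, add_mem hm hn, (hx.add hy).congr fun N =>
        ((zakAverageLinear e N).map_add x y).symm⟩
    | smul c x _ hx =>
      obtain ⟨m, hm, hx⟩ := hx
      exact ⟨c • m, SMulMemClass.smul_mem c hm, (hx.const_smul c).congr fun N =>
        ((zakAverageLinear e N).map_smul c x).symm⟩
  -- Three-epsilon argument: the averages are contractions uniformly in `N`.
  have hcauchy : CauchySeq fun N => zakAverage e N a := by
    rw [Metric.cauchySeq_iff]
    intro ε hε
    obtain ⟨b, hb, hab⟩ := Metric.mem_closure_iff.1 (dense_span_weylUV a) (ε / 3) (by positivity)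
    obtain ⟨m, -, hm⟩ := hspan b hb
    obtain ⟨N₀, hN₀⟩ := Metric.cauchySeq_iff.1 hm.cauchySeq (ε / 3) (by positivity)
    have hdist : ∀ N, dist (zakAverage e N a) (zakAverage e N b) < ε / 3 := fun N => by
      rw [dist_eq_norm, ← zakAverageLinear_apply, ← zakAverageLinear_apply, ← map_sub]
      exact (norm_zakAverage_le e N _).trans_lt (by rwa [← dist_eq_norm])
    refine ⟨N₀, fun M hM N hN => ?_⟩
    calc _ ≤ dist (zakAverage e M a) (zakAverage e M b)
          + dist (zakAverage e M b) (zakAverage e N b)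
          + dist (zakAverage e N b) (zakAverage e N a) := dist_triangle4 _ _ _ _
      _ < ε / 3 + ε / 3 + ε / 3 := by
          gcongr
          · exact hdist M
          · exact hN₀ M hM N hN
          · rw [dist_comm]; exact hdist N
      _ = ε := by ring
  obtain ⟨m, hm⟩ := cauchySeq_tendsto_of_complete hcauchy
  refine ⟨m, ?_, hm⟩
  have hclosed : IsClosed (zakSubalgebra e : Set (WeylAlgebra d)) := inferInstance
  -- By contractivity the mean of an approximant `b` is at least as close to `m` as `b` is to `a`.
  refine (hclosed.closure_eq ▸ Metric.mem_closure_iff.2 fun ε hε => ?_ :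
    m ∈ (zakSubalgebra e : Set (WeylAlgebra d)))
  obtain ⟨b, hb, hab⟩ := Metric.mem_closure_iff.1 (dense_span_weylUV a) ε hε
  obtain ⟨n, hn, hbn⟩ := hspan b hb
  refine ⟨n, hn, lt_of_le_of_lt ?_ hab⟩
  refine le_of_tendsto (hm.dist hbn) (Filter.Eventually.of_forall fun N => ?_)
  rw [dist_eq_norm, dist_eq_norm, ← zakAverageLinear_apply, ← zakAverageLinear_apply, ← map_sub]
  exact norm_zakAverage_le e N _

/-- On generators the phases `e^{-iγ'·δ}` equal 1 by duality; the generators are also stable under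
adjoints, so commutativity passes to the closed algebra. -/
lemma zakSubalgebra_mul_comm (e : Basis (Fin d) ℝ (RSpace d)) :
    ∀ x ∈ zakSubalgebra e, ∀ y ∈ zakSubalgebra e, x * y = y * x := by
  set s : Set (WeylAlgebra d) :=
    {a | ∃ γ ∈ lattice e, ∃ γ' ∈ dualLattice e, a = weylU γ' * weylV γ} with hs
  have hcomm : ∀ x ∈ s, ∀ y ∈ s, x * y = y * x := by
    rintro _ ⟨γ, hγ, γ', hγ', rfl⟩ _ ⟨δ, hδ, δ', hδ', rfl⟩
    have h1 := phase_inner_eq_one (neg_mem_lattice hγ) hδ'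
    have h2 := phase_inner_eq_one (neg_mem_lattice hδ) hγ'
    rw [inner_neg_right] at h1 h2
    rw [weylUV_mul_weylUV, weylUV_mul_weylUV, h1, h2, add_comm γ', add_comm γ]
  have hstar : ∀ x ∈ s, star x ∈ s := by
    rintro _ ⟨γ, hγ, γ', hγ', rfl⟩
    refine ⟨-γ, neg_mem_lattice hγ, -γ', neg_mem_dualLattice hγ', ?_⟩
    rw [star_mul, star_weylU, star_weylV, weylV_mul_weylU, inner_neg_neg,
      ← inner_neg_right, phase_inner_eq_one (neg_mem_lattice hγ) hγ', one_smul]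
  have hmul := StarAlgebra.isMulCommutative_adjoin ℂ hcomm
    fun a ha b hb => hcomm a ha _ (hstar b hb)
  let _ := StarSubalgebra.commRingTopologicalClosure (StarAlgebra.adjoin ℂ s)
    fun x y => hmul.is_comm.comm x y
  intro x hx y hy
  exact congrArg Subtype.val (mul_comm (⟨x, hx⟩ : (StarAlgebra.adjoin ℂ s).topologicalClosure)
    ⟨y, hy⟩)

/-- The ergodic mean as a linear map into `ℤ_Γ`. -/
noncomputable def zakMean (e : Basis (Fin d) ℝ (RSpace d)) :
    WeylAlgebra d →L[ℂ] zakSubalgebra e :=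
  have hmean : ∀ a, IsZakMean e a (exists_isZakMean e a).choose := fun a =>
    (exists_isZakMean e a).choose_spec.2
  LinearMap.mkContinuous
    { toFun := fun a => ⟨(exists_isZakMean e a).choose, (exists_isZakMean e a).choose_spec.1⟩
      map_add' := fun a b => Subtype.ext <| tendsto_nhds_unique (hmean (a + b)) <|
        ((hmean a).add (hmean b)).congr fun N => ((zakAverageLinear e N).map_add a b).symm
      map_smul' := fun c a => Subtype.ext <| tendsto_nhds_unique (hmean (c • a)) <|
        ((hmean a).const_smul c).congr fun N => ((zakAverageLinear e N).map_smul c a).symm }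
    1 fun a => by
      rw [one_mul]
      exact le_of_tendsto (hmean a).norm
        (Filter.Eventually.of_forall fun N => norm_zakAverage_le e N a)

lemma isZakMean_zakMean (e : Basis (Fin d) ℝ (RSpace d)) (a : WeylAlgebra d) :
    IsZakMean e a (zakMean e a) :=
  (exists_isZakMean e a).choose_spec.2

lemma zakMean_eq (e : Basis (Fin d) ℝ (RSpace d)) {a : WeylAlgebra d} {m : zakSubalgebra e}
    (h : IsZakMean e a m) : zakMean e a = m :=
  Subtype.ext (tendsto_nhds_unique (isZakMean_zakMean e a) h)

/-- By commutativity the conjugating unitaries fix `ℤ_Γ` pointwise, so every partial average is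
already `z`. -/
lemma zakMean_coe (e : Basis (Fin d) ℝ (RSpace d)) (z : zakSubalgebra e) :
    zakMean e (z : WeylAlgebra d) = z := by
  refine zakMean_eq e (tendsto_const_nhds.congr fun N => ?_)
  refine (average_const e N (z : WeylAlgebra d)).symm.trans ?_
  rw [zakAverage]
  congr 1
  refine Finset.sum_congr rfl fun γ hγ => Finset.sum_congr rfl fun γ' hγ' => ?_
  rw [translation_eq, zakSubalgebra_mul_comm e _
    (weylVU_mem_zakSubalgebra (latticeBox_subset_lattice e N hγ)
      (dualLatticeBox_subset_dualLattice e N hγ')) _ z.2, mul_assoc,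
    (weylVU_mem_unitary γ γ').2, mul_one]

lemma zakMean_one (e : Basis (Fin d) ℝ (RSpace d)) : zakMean e 1 = 1 := zakMean_coe e 1

/-- The mean is invariant under lattice translations. -/
lemma zakMean_translation (e : Basis (Fin d) ℝ (RSpace d)) {γ γ' : RSpace d} (hγ : γ ∈ lattice e)
    (hγ' : γ' ∈ dualLattice e) (a : WeylAlgebra d) :
    zakMean e (spaceTranslation γ (momentumTranslation γ' a)) = zakMean e a := by
  set w := weylV γ * weylU γ' with hw
  have hwmem : w ∈ zakSubalgebra e := weylVU_mem_zakSubalgebra hγ hγ'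
  refine zakMean_eq e ?_
  -- No shift of boxes is needed: conjugation by `w` fixes the limit, which lies in `ℤ_Γ`, and
  -- commutes with the averages because `w` commutes with the unitaries of the box.
  have h : Filter.Tendsto (fun N => w * zakAverage e N a * star w) Filter.atTop
      (nhds (w * zakMean e a * star w)) :=
    ((isZakMean_zakMean e a).const_mul w).mul_const (star w)
  rw [zakSubalgebra_mul_comm e w hwmem _ (zakMean e a).2, mul_assoc,
    (weylVU_mem_unitary γ γ').2, mul_one] at h
  refine h.congr fun N => ?_
  simp only [zakAverage, mul_smul_comm, smul_mul_assoc, Finset.mul_sum, Finset.sum_mul]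
  congr 1
  refine Finset.sum_congr rfl fun δ hδ => Finset.sum_congr rfl fun δ' hδ' => ?_
  have hc := zakSubalgebra_mul_comm e w hwmem _
    (weylVU_mem_zakSubalgebra (latticeBox_subset_lattice e N hδ)
      (dualLatticeBox_subset_dualLattice e N hδ'))
  rw [translation_eq, translation_eq, translation_eq]
  calc _ = (w * (weylV δ * weylU δ')) * a * star (w * (weylV δ * weylU δ')) := by
        rw [star_mul w]; simp only [mul_assoc]
    _ = _ := by rw [hc, star_mul _ w]; simp only [mul_assoc, ← hw]

end Mean

/-! ### States and pure states -/

section States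

variable {A B : Type*} [CStarAlgebra A] [CStarAlgebra B]

/-- Precomposition of a functional with a continuous linear map. -/
noncomputable def WeakDual.precomp (ω : WeakDual ℂ B) (f : A →L[ℂ] B) : WeakDual ℂ A :=
  StrongDual.toWeakDual ((WeakDual.toStrongDual ω).comp f)

lemma WeakDual.precomp_apply (ω : WeakDual ℂ B) (f : A →L[ℂ] B) (a : A) :
    ω.precomp f a = ω (f a) := rfl

lemma WeakDual.real_smul_apply (r : ℝ) (ω : WeakDual ℂ A) (a : A) : (r • ω) a = r * ω a := rfl

lemma WeakDual.add_apply' (ω ψ : WeakDual ℂ A) (a : A) : (ω + ψ) a = ω a + ψ a := rfl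

lemma stateSpace.nonneg [PartialOrder A] [StarOrderedRing A] {ω : WeakDual ℂ A}
    (hω : ω ∈ stateSpace A) {a : A} (ha : 0 ≤ a) : 0 ≤ ω a := by
  obtain ⟨b, rfl⟩ := CStarAlgebra.nonneg_iff_eq_star_mul_self.1 ha
  exact hω.2 b

/-- A state as a positive linear map. -/
noncomputable def stateSpace.toPositive [PartialOrder A] [StarOrderedRing A] {ω : WeakDual ℂ A}
    (hω : ω ∈ stateSpace A) : A →ₚ[ℂ] ℂ :=
  PositiveLinearMap.mk₀ (WeakDual.toStrongDual ω).toLinearMap fun _ ha => stateSpace.nonneg hω ha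

lemma stateSpace.map_star {ω : WeakDual ℂ A} (hω : ω ∈ stateSpace A) (a : A) :
    ω (star a) = star (ω a) := by
  let _ := CStarAlgebra.spectralOrder A
  have _ := CStarAlgebra.spectralOrderedRing A
  exact StarHomClass.map_star (stateSpace.toPositive hω) a

/-- Cauchy–Schwarz for the GNS semi-inner product: `b` is a null vector. -/
lemma stateSpace.apply_mul_eq_zero {ω : WeakDual ℂ A} (hω : ω ∈ stateSpace A) {b : A}
    (hb : ω (star b * b) = 0) (a : A) : ω (a * b) = 0 := by
  let _ := CStarAlgebra.spectralOrder A
  have _ := CStarAlgebra.spectralOrderedRing A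
  let f := stateSpace.toPositive hω
  have hnorm : ‖f.toPreGNS b‖ = 0 := by
    rw [f.preGNS_norm_def]
    change √(ω (star b * b)).re = 0
    rw [hb]
    simp
  have h := norm_inner_le_norm (𝕜 := ℂ) (f.toPreGNS (star a)) (f.toPreGNS b)
  rw [hnorm, mul_zero, f.preGNS_inner_def] at h
  change ‖ω (star (star a) * b)‖ ≤ 0 at h
  rw [star_star] at h
  exact norm_le_zero_iff.1 h

/-- A state is invariant under a unitary on which it has modulus one. -/
lemma stateSpace.apply_conj {ω : WeakDual ℂ A} (hω : ω ∈ stateSpace A) {w : A}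
    (hw : w ∈ unitary A) (h : ‖ω w‖ = 1) (a : A) : ω (w * a * star w) = ω a := by
  set c := ω w with hc
  have hcc : c * star c = 1 := by
    rw [Complex.star_def, Complex.mul_conj, Complex.normSq_eq_norm_sq, h]; simp
  -- Chosen so that `ω (star b * b) = 1 - |c|² = 0`: in the GNS picture the cyclic vector is an
  -- eigenvector of `star w`.
  set b := star w - star c • (1 : A) with hb
  have hbs : star b = w - c • (1 : A) := by simp [hb]
  have hzero : ω (star b * b) = 0 := by
    have hexp : star b * b = w * star w - star c • w - c • star w + (c * star c) • (1 : A) := by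
      rw [hbs, hb]
      simp only [sub_mul, mul_sub, smul_mul_assoc, mul_smul_comm, one_mul, mul_one, smul_sub,
        smul_smul, mul_comm]
      abel
    rw [hexp, hw.2]
    simp only [map_add, map_sub, map_smul, hω.1, stateSpace.map_star hω, ← hc, smul_eq_mul]
    linear_combination (-1 : ℂ) * hcc
  have hright : ∀ x, ω (x * star w) = star c * ω x := fun x => by
    have h1 := stateSpace.apply_mul_eq_zero hω hzero x
    rw [hb, mul_sub, mul_smul_comm, mul_one, map_sub, map_smul, sub_eq_zero] at h1
    exact h1
  have hleft : ∀ x, ω (w * x) = c * ω x := fun x => by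
    have h1 := congrArg star (hright (star x))
    rwa [← stateSpace.map_star hω, star_mul', ← stateSpace.map_star hω, star_mul, star_star,
      star_star, stateSpace.map_star hω, stateSpace.map_star hω, star_star, star_star] at h1
  rw [hright, hleft, ← mul_assoc, mul_comm (star c), hcc, one_mul]

/-- Cutting down a state of a commutative algebra by a positive element. -/
lemma stateSpace.cut_mem [PartialOrder A] [StarOrderedRing A] (hcomm : ∀ x y : A, x * y = y * x)
    {ω : WeakDual ℂ A} (hω : ω ∈ stateSpace A) {b : A} (hb : 0 ≤ b) {t : ℝ} (ht : 0 < t)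
    (hbt : ω b = t) :
    t⁻¹ • ω.precomp (ContinuousLinearMap.mul ℂ A b) ∈ stateSpace A := by
  have ht0 : (t : ℂ) ≠ 0 := by exact_mod_cast ht.ne'
  constructor
  · rw [WeakDual.real_smul_apply, WeakDual.precomp_apply, ContinuousLinearMap.mul_apply', mul_one,
      hbt, Complex.ofReal_inv, inv_mul_cancel₀ ht0]
  · intro a
    rw [WeakDual.real_smul_apply, WeakDual.precomp_apply, ContinuousLinearMap.mul_apply']
    obtain ⟨x, rfl⟩ := CStarAlgebra.nonneg_iff_eq_star_mul_self.1 hb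
    -- Commutativity rewrites the cut-down value as `ω` of a square.
    have hx : star x * x * (star a * a) = star (x * a) * (x * a) := by
      rw [star_mul, hcomm _ (star a * a), mul_assoc, hcomm a, mul_assoc, mul_assoc]
    rw [hx]
    exact mul_nonneg (by exact_mod_cast (inv_pos.2 ht).le) (hω.2 _)

/-- The cuts of `ω` by `b` and `1 - b`, normalized, are states with convex combination `ω` for
weights `t` and `1 - t`; extremality makes the first equal to `ω`. -/
lemma pureStates.apply_mul_of_nonneg [PartialOrder A] [StarOrderedRing A]
    (hcomm : ∀ x y : A, x * y = y * x) {ω : WeakDual ℂ A} (hω : ω ∈ pureStates A) {b : A}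
    (hb : 0 ≤ b) (hb1 : 0 ≤ 1 - b) {t : ℝ} (ht : 0 < t) (ht1 : 0 < 1 - t) (hbt : ω b = t)
    (a : A) : ω (b * a) = ω b * ω a := by
  have ht0 : (t : ℂ) ≠ 0 := by exact_mod_cast ht.ne'
  have h1 := stateSpace.cut_mem hcomm hω.1 hb ht hbt
  have h2 := stateSpace.cut_mem hcomm hω.1 hb1 ht1
    (by rw [map_sub, hω.1.1, hbt]; push_cast; rfl)
  have hmem : ω ∈ openSegment ℝ (t⁻¹ • ω.precomp (ContinuousLinearMap.mul ℂ A b))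
      ((1 - t)⁻¹ • ω.precomp (ContinuousLinearMap.mul ℂ A (1 - b))) := by
    refine ⟨t, 1 - t, ht, ht1, by ring, ?_⟩
    refine DFunLike.ext _ _ fun x => ?_
    have ht1' : ((1 - t : ℝ) : ℂ) ≠ 0 := by exact_mod_cast ht1.ne'
    simp only [WeakDual.add_apply', WeakDual.real_smul_apply, WeakDual.precomp_apply,
      Complex.ofReal_inv, mul_inv_cancel_left₀ ht0, mul_inv_cancel_left₀ ht1']
    rw [← map_add, ContinuousLinearMap.mul_apply', ContinuousLinearMap.mul_apply', ← add_mul,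
      add_sub_cancel, one_mul]
  have heq := ((mem_extremePoints.1 hω).2 _ h1 _ h2 hmem).1
  have ha := congrArg (fun φ : WeakDual ℂ A => φ a) heq
  simp only [WeakDual.real_smul_apply, WeakDual.precomp_apply, ContinuousLinearMap.mul_apply',
    Complex.ofReal_inv] at ha
  rw [hbt, ← ha, mul_inv_cancel_left₀ ht0]

lemma pureStates.apply_mul_of_isSelfAdjoint (hcomm : ∀ x y : A, x * y = y * x) {ω : WeakDual ℂ A}
    (hω : ω ∈ pureStates A) {h : A} (hsa : IsSelfAdjoint h) (hnorm : ‖h‖ ≤ 1) (a : A) :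
    ω (h * a) = ω h * ω a := by
  let _ := CStarAlgebra.spectralOrder A
  have _ := CStarAlgebra.spectralOrderedRing A
  have hle : ∀ x : A, IsSelfAdjoint x → ‖x‖ ≤ 1 → 0 ≤ 1 - x := fun x hx hx1 => by
    rw [sub_nonneg]
    refine (hx.le_algebraMap_norm_self).trans ?_
    simpa using (algebraMap_mono A hx1 : algebraMap ℝ A ‖x‖ ≤ algebraMap ℝ A 1)
  have hp : 0 ≤ 1 - h := hle h hsa hnorm
  have hm : 0 ≤ 1 + h := by simpa using hle (-h) hsa.neg (by rwa [norm_neg])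
  have hp' := stateSpace.nonneg hω.1 hp
  have hm' := stateSpace.nonneg hω.1 hm
  have hone : (0 : A) ≤ 1 := by simp
  rw [map_sub, hω.1.1] at hp'
  rw [map_add, hω.1.1] at hm'
  -- The affine image `1/2 + h/4` lies between `1/4` and `3/4`, so `ω b` avoids the degenerate
  -- values 0 and 1; multiplicativity returns to `h` by linearity.
  set b : A := (1 / 4 : ℝ) • (1 + h + 1) with hbdef
  have hb : 0 ≤ b := smul_nonneg (by norm_num) (add_nonneg hm hone)
  have hb1 : 0 ≤ 1 - b := by
    have : 1 - b = (1 / 4 : ℝ) • (1 - h + 1) := by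
      rw [hbdef]
      module
    rw [this]
    exact smul_nonneg (by norm_num) (add_nonneg hp hone)
  have hreal : ω h = ((ω h).re : ℂ) := by
    have := stateSpace.map_star hω.1 h
    rw [hsa.star_eq] at this
    exact (Complex.conj_eq_iff_re.1 this.symm).symm
  have hbh : b = (1 / 2 : ℂ) • (1 : A) + (1 / 4 : ℂ) • h := by
    rw [hbdef, ← Complex.coe_smul]
    push_cast
    module
  have hωb : ω b = ((1 / 2 + 1 / 4 * (ω h).re : ℝ) : ℂ) := by
    rw [hbh, map_add, map_smul, map_smul, hω.1.1, hreal]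
    simp
  have hp'' := (Complex.le_def.1 hp').1
  have hm'' := (Complex.le_def.1 hm').1
  simp only [Complex.zero_re, Complex.sub_re, Complex.add_re, Complex.one_re] at hp'' hm''
  have key := pureStates.apply_mul_of_nonneg hcomm hω hb hb1 (by linarith) (by linarith) hωb a
  rw [hbh] at key
  simp only [add_mul, smul_mul_assoc, one_mul, map_add, map_smul, hω.1.1, smul_eq_mul] at key
  linear_combination 4 * key

/-- Pure states of a commutative C*-algebra have modulus one on unitaries. -/
lemma pureStates.norm_apply_unitary (hcomm : ∀ x y : A, x * y = y * x) {ω : WeakDual ℂ A}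
    (hω : ω ∈ pureStates A) {w : A} (hw : w ∈ unitary A) : ‖ω w‖ = 1 := by
  have _ : Nontrivial A := ⟨1, 0, fun h => by simpa [h] using hω.1.1⟩
  have hw1 : ‖w‖ ≤ 1 := (CStarRing.norm_of_mem_unitary hw).le
  have hre : ∀ a, ω ((realPart w : A) * a) = ω (realPart w : A) * ω a :=
    pureStates.apply_mul_of_isSelfAdjoint hcomm hω (realPart w).2
      ((realPart.norm_le w).trans hw1)
  have him : ∀ a, ω ((imaginaryPart w : A) * a) = ω (imaginaryPart w : A) * ω a :=
    pureStates.apply_mul_of_isSelfAdjoint hcomm hω (imaginaryPart w).2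
      ((imaginaryPart.norm_le w).trans hw1)
  have hmul : ω (w * star w) = ω w * ω (star w) := by
    have hdec := realPart_add_I_smul_imaginaryPart w
    -- Shields `star w` from the decomposition of `w` into real and imaginary parts.
    generalize star w = a
    rw [← hdec, add_mul, map_add, smul_mul_assoc, map_smul, hre, him, map_add, map_smul,
      smul_eq_mul, smul_eq_mul]
    ring
  rw [hw.2, hω.1.1, stateSpace.map_star hω.1, Complex.star_def, Complex.mul_conj,
    Complex.normSq_eq_norm_sq] at hmul
  have h2 : ‖ω w‖ ^ 2 = 1 := by exact_mod_cast hmul.symm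
  exact (pow_eq_one_iff_of_nonneg (norm_nonneg _) two_ne_zero).1 h2

/-- Positivity in a C*-subalgebra is positivity in the algebra. -/
lemma StarSubalgebra.exists_eq_star_mul_self (S : StarSubalgebra ℂ A) [IsClosed (S : Set A)]
    [PartialOrder A] [StarOrderedRing A] {x : S} (hx : 0 ≤ (x : A)) :
    ∃ y : S, x = star y * y := by
  let _ := CStarAlgebra.spectralOrder S
  have _ := CStarAlgebra.spectralOrderedRing S
  have hsaA : IsSelfAdjoint (x : A) := IsSelfAdjoint.of_nonneg hx
  have hsa : IsSelfAdjoint x := Subtype.ext hsaA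
  refine CStarAlgebra.nonneg_iff_eq_star_mul_self.1 ?_
  -- Positivity is spectral, and the complex spectrum does not change on passing to a closed star
  -- subalgebra.
  rw [StarOrderedRing.nonneg_iff_spectrum_nonneg (R := ℝ) x hsa, ← spectrum.preimage_algebraMap ℂ,
    StarSubalgebra.spectrum_eq, spectrum.preimage_algebraMap ℂ]
  exact (StarOrderedRing.nonneg_iff_spectrum_nonneg (R := ℝ) (x : A) hsaA).1 hx

end States

/-! ### Zak states -/

section ZakStates

variable {d : ℕ}

/-- The mean of a positive element is positive. -/
lemma exists_zakMean_star_mul_self (e : Basis (Fin d) ℝ (RSpace d)) (a : WeylAlgebra d) :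
    ∃ z : zakSubalgebra e, zakMean e (star a * a) = star z * z := by
  let _ := CStarAlgebra.spectralOrder (WeylAlgebra d)
  have _ := CStarAlgebra.spectralOrderedRing (WeylAlgebra d)
  refine StarSubalgebra.exists_eq_star_mul_self (zakSubalgebra e) ?_
  -- The positive cone is closed, and each average is a positive combination of conjugates of `star
  -- a * a`.
  refine ge_of_tendsto' (isZakMean_zakMean e (star a * a)) fun N => ?_
  have hscal : (1 / (((2 * N + 1) ^ d) ^ 2 : ℂ)) = ((1 / (((2 * N + 1) ^ d) ^ 2) : ℝ) : ℂ) := by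
    push_cast
    rfl
  rw [zakAverage, hscal, Complex.coe_smul]
  refine smul_nonneg (by positivity) (Finset.sum_nonneg fun γ _ => Finset.sum_nonneg fun γ' _ => ?_)
  rw [translation_eq]
  exact star_right_conjugate_nonneg (star_mul_self_nonneg a) _

lemma precomp_zakMean_mem_zakStates (e : Basis (Fin d) ℝ (RSpace d))
    {ω : WeakDual ℂ (zakSubalgebra e)} (hω : ω ∈ stateSpace (zakSubalgebra e)) :
    ω.precomp (zakMean e) ∈ zakStates e := by
  refine ⟨⟨?_, fun a => ?_⟩, fun γ hγ γ' hγ' a => ?_⟩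
  · rw [WeakDual.precomp_apply, zakMean_one, hω.1]
  · obtain ⟨z, hz⟩ := exists_zakMean_star_mul_self e a
    rw [WeakDual.precomp_apply, hz]
    exact hω.2 z
  · rw [WeakDual.precomp_apply, WeakDual.precomp_apply, zakMean_translation e hγ hγ']

/-- The inclusion `ℤ_Γ → 𝕎`. -/
noncomputable def zakInclusion (e : Basis (Fin d) ℝ (RSpace d)) :
    zakSubalgebra e →L[ℂ] WeylAlgebra d :=
  (zakSubalgebra e).toSubalgebra.toSubmodule.subtypeL

lemma zakInclusion_apply (e : Basis (Fin d) ℝ (RSpace d)) (z : zakSubalgebra e) :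
    zakInclusion e z = z := rfl

lemma precomp_zakInclusion_mem_stateSpace (e : Basis (Fin d) ℝ (RSpace d))
    {ω : WeakDual ℂ (WeylAlgebra d)} (hω : ω ∈ stateSpace (WeylAlgebra d)) :
    ω.precomp (zakInclusion e) ∈ stateSpace (zakSubalgebra e) :=
  ⟨hω.1, fun z => hω.2 z⟩

/-- A Zak state is determined by its restriction to `ℤ_Γ`. -/
lemma apply_zakMean_of_mem_zakStates (e : Basis (Fin d) ℝ (RSpace d))
    {ω : WeakDual ℂ (WeylAlgebra d)} (hω : ω ∈ zakStates e) (a : WeylAlgebra d) :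
    ω (zakMean e a) = ω a := by
  -- By invariance `ω` is constant along the averages, and it is norm continuous.
  refine tendsto_nhds_unique
    (((WeakDual.toStrongDual ω).continuous.tendsto _).comp (isZakMean_zakMean e a))
    (tendsto_const_nhds.congr fun N => ?_)
  change ω a = ω (zakAverage e N a)
  rw [zakAverage, map_smul, map_sum]
  refine (average_const e N (ω a)).symm.trans ?_
  congr 1
  refine Finset.sum_congr rfl fun γ hγ => ?_
  rw [map_sum]
  exact Finset.sum_congr rfl fun γ' hγ' =>
    (hω.2 γ (latticeBox_subset_lattice e N hγ) γ'
      (dualLatticeBox_subset_dualLattice e N hγ') a).symm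

lemma precomp_zakMean_zakInclusion (e : Basis (Fin d) ℝ (RSpace d))
    (ω : WeakDual ℂ (zakSubalgebra e)) :
    (ω.precomp (zakMean e)).precomp (zakInclusion e) = ω :=
  DFunLike.ext _ _ fun z => by
    rw [WeakDual.precomp_apply, WeakDual.precomp_apply, zakInclusion_apply, zakMean_coe]

lemma precomp_zakInclusion_zakMean (e : Basis (Fin d) ℝ (RSpace d))
    {ω : WeakDual ℂ (WeylAlgebra d)} (hω : ω ∈ zakStates e) :
    (ω.precomp (zakInclusion e)).precomp (zakMean e) = ω :=
  DFunLike.ext _ _ fun a => by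
    rw [WeakDual.precomp_apply, WeakDual.precomp_apply, zakInclusion_apply,
      apply_zakMean_of_mem_zakStates e hω]

lemma WeakDual.continuous_precomp {A B : Type*} [CStarAlgebra A] [CStarAlgebra B] (f : A →L[ℂ] B) :
    Continuous fun ω : WeakDual ℂ B => ω.precomp f :=
  WeakDual.continuous_of_continuous_eval fun a => WeakDual.eval_continuous (f a)

lemma WeakDual.precomp_mem_openSegment {A B : Type*} [CStarAlgebra A] [CStarAlgebra B]
    (f : A →L[ℂ] B) {ω ω₁ ω₂ : WeakDual ℂ B} (h : ω ∈ openSegment ℝ ω₁ ω₂) :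
    ω.precomp f ∈ openSegment ℝ (ω₁.precomp f) (ω₂.precomp f) := by
  obtain ⟨s, t, hs, ht, hst, rfl⟩ := h
  exact ⟨s, t, hs, ht, hst, rfl⟩

/-- The homeomorphism `S_{ℤ_Γ} ≃ S^Z`. -/
noncomputable def zakStateHomeomorph (e : Basis (Fin d) ℝ (RSpace d)) :
    stateSpace (zakSubalgebra e) ≃ₜ zakStates e where
  toFun ω := ⟨_, precomp_zakMean_mem_zakStates e ω.2⟩
  invFun ω := ⟨_, precomp_zakInclusion_mem_stateSpace e ω.2.1⟩
  left_inv ω := Subtype.ext (precomp_zakMean_zakInclusion e ω)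
  right_inv ω := Subtype.ext (precomp_zakInclusion_zakMean e ω.2)
  continuous_toFun :=
    ((WeakDual.continuous_precomp (zakMean e)).comp continuous_subtype_val).subtype_mk _
  continuous_invFun :=
    ((WeakDual.continuous_precomp (zakInclusion e)).comp continuous_subtype_val).subtype_mk _

/-- A state whose restriction to `ℤ_Γ` is pure is a Zak state. -/
lemma mem_zakStates_of_precomp_mem_pureStates (e : Basis (Fin d) ℝ (RSpace d))
    {ω : WeakDual ℂ (WeylAlgebra d)} (hω : ω ∈ stateSpace (WeylAlgebra d))
    (hpure : ω.precomp (zakInclusion e) ∈ pureStates (zakSubalgebra e)) : ω ∈ zakStates e := by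
  refine ⟨hω, fun γ hγ γ' hγ' a => ?_⟩
  rw [translation_eq]
  have hw := weylVU_mem_unitary γ γ'
  refine stateSpace.apply_conj hω hw ?_ a
  let w : zakSubalgebra e := ⟨weylV γ * weylU γ', weylVU_mem_zakSubalgebra hγ hγ'⟩
  have hcomm : ∀ x y : zakSubalgebra e, x * y = y * x := fun x y =>
    Subtype.ext (zakSubalgebra_mul_comm e x x.2 y y.2)
  have hw' : w ∈ unitary (zakSubalgebra e) := ⟨Subtype.ext hw.1, Subtype.ext hw.2⟩
  exact pureStates.norm_apply_unitary hcomm hpure hw'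

/-- Both components of a decomposition restrict to the pure `ω`, are therefore Zak states, and so
are recovered from `ω` through the mean. -/
lemma precomp_zakMean_mem_pureZakStates (e : Basis (Fin d) ℝ (RSpace d))
    {ω : WeakDual ℂ (zakSubalgebra e)} (hω : ω ∈ pureStates (zakSubalgebra e)) :
    ω.precomp (zakMean e) ∈ pureZakStates e := by
  have hzak := precomp_zakMean_mem_zakStates e hω.1
  refine ⟨hzak, mem_extremePoints.2 ⟨hzak.1, fun ω₁ h₁ ω₂ h₂ h => ?_⟩⟩
  have hseg := WeakDual.precomp_mem_openSegment (zakInclusion e) h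
  rw [precomp_zakMean_zakInclusion] at hseg
  have heq := (mem_extremePoints.1 hω).2 _ (precomp_zakInclusion_mem_stateSpace e h₁)
    _ (precomp_zakInclusion_mem_stateSpace e h₂) hseg
  have key : ∀ ψ ∈ stateSpace (WeylAlgebra d), ψ.precomp (zakInclusion e) = ω →
      ψ = ω.precomp (zakMean e) := fun ψ hψ hψω => by
    rw [← precomp_zakInclusion_zakMean e
      (mem_zakStates_of_precomp_mem_pureStates e hψ (hψω ▸ hω)), hψω]
  exact ⟨key ω₁ h₁ heq.1, key ω₂ h₂ heq.2⟩

/-- A decomposition on `ℤ_Γ` lifts through the mean to one on `𝕎`, trivial by purity there;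
restricting back recovers its components. -/
lemma precomp_zakInclusion_mem_pureStates (e : Basis (Fin d) ℝ (RSpace d))
    {ω : WeakDual ℂ (WeylAlgebra d)} (hω : ω ∈ pureZakStates e) :
    ω.precomp (zakInclusion e) ∈ pureStates (zakSubalgebra e) := by
  refine mem_extremePoints.2
    ⟨precomp_zakInclusion_mem_stateSpace e hω.1.1, fun ω₁ h₁ ω₂ h₂ h => ?_⟩
  have hseg := WeakDual.precomp_mem_openSegment (zakMean e) h
  rw [precomp_zakInclusion_zakMean e hω.1] at hseg
  have heq := (mem_extremePoints.1 hω.2).2 _ (precomp_zakMean_mem_zakStates e h₁).1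
    _ (precomp_zakMean_mem_zakStates e h₂).1 hseg
  rw [← precomp_zakMean_zakInclusion e ω₁, ← precomp_zakMean_zakInclusion e ω₂, heq.1, heq.2]
  exact ⟨rfl, rfl⟩

/-- The homeomorphism `P_{ℤ_Γ} ≃ P^Z`. -/
noncomputable def pureZakStateHomeomorph (e : Basis (Fin d) ℝ (RSpace d)) :
    pureStates (zakSubalgebra e) ≃ₜ pureZakStates e where
  toFun ω := ⟨_, precomp_zakMean_mem_pureZakStates e ω.2⟩
  invFun ω := ⟨_, precomp_zakInclusion_mem_pureStates e ω.2⟩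
  left_inv ω := Subtype.ext (precomp_zakMean_zakInclusion e ω)
  right_inv ω := Subtype.ext (precomp_zakInclusion_zakMean e ω.2.1)
  continuous_toFun :=
    ((WeakDual.continuous_precomp (zakMean e)).comp continuous_subtype_val).subtype_mk _
  continuous_invFun :=
    ((WeakDual.continuous_precomp (zakInclusion e)).comp continuous_subtype_val).subtype_mk _

end ZakStates

theorem mainTheorem7 {d : ℕ} (e : Module.Basis (Fin d) ℝ (RSpace d)) :
    (∀ x ∈ zakSubalgebra e, ∀ y ∈ zakSubalgebra e, x * y = y * x) ∧
    ∃ mean : WeylAlgebra d → zakSubalgebra e,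
      (∀ a, IsZakMean e a (mean a)) ∧
      ∃ Φ : stateSpace (zakSubalgebra e) ≃ₜ zakStates e,
        (∀ (ω : stateSpace (zakSubalgebra e)) (a : WeylAlgebra d),
          (Φ ω : WeakDual ℂ (WeylAlgebra d)) a
            = (ω : WeakDual ℂ (zakSubalgebra e)) (mean a)) ∧
        ∃ Ψ : pureStates (zakSubalgebra e) ≃ₜ pureZakStates e,
          ∀ ω : pureStates (zakSubalgebra e),
            (Ψ ω : WeakDual ℂ (WeylAlgebra d)) = Φ ⟨ω, ω.2.1⟩ :=
  ⟨zakSubalgebra_mul_comm e, zakMean e, isZakMean_zakMean e, zakStateHomeomorph e,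
    fun _ _ => rfl, pureZakStateHomeomorph e, fun _ => rfl⟩
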